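/- Let $\Gamma$ be a strongly regular graph on a finite set of $n$ vertices, neither complete nor empty, with adjacency matrix $A_1$; let $A_0=I$ and let $A_2$ be the adjacency matrix of the complement of $\Gamma$. Let $(k_1,r,s)$ be the eigenvalues of $\Gamma$: $k_1$ is its valency, and $r\ge 0$ and $s\le -1$ are the two eigenvalues of $A_1$ on the orthogonal complement of the all-ones vector. Assume that $r+s\ge -1$ (this holds for $\Gamma$ or for its complement). Let $w_0,w_1,w_2$ be complex numbers of absolute value $1$ with $w_1\neq w_2$, and put $$W_1=w_0A_0+w_1A_1+w_2A_2,\qquad W=\begin{pmatrix}1&\boldsymbol e\\ \boldsymbol e^{\top}&W_1\end{pmatrix},$$ where $\boldsymbol e$ is the all-ones row vector of length $n$. A complex Hadamard matrix of order $N$ is an $N\times N$ matrix $H$ whose entries have absolute value $1$ and which satisfies $H\overline{H}^{\top}=NI$. A conference graph is a strongly regular graph (neither complete nor empty) whose eigenvalues $(k,\rho,\sigma)$, with $\rho\ge 0$ and $\sigma\le -1$, satisfy $k=2\rho(\rho+1)$ and $\rho+\sigma=-1$. Then $W$ is a complex Hadamard matrix if and only if one of the following holds. (i) $\Gamma$ is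 a conference graph on $n=(2r+1)^2$ vertices, and, with all upper signs or all lower signs, (a) $(w_0,w_1,w_2)=(-1,\pm i,\mp i)$, or (b) $(w_0,w_1,w_2)=\left(1,\ \dfrac{-1\pm i\sqrt{4r^2(r+1)^2-1}}{2r(r+1)},\ \dfrac{-1\mp i\sqrt{4r^2(r+1)^2-1}}{2r(r+1)}\right)$. (ii) $\Gamma$ has eigenvalues $(k_1,r,s)=(2r^2,r,-r)$, and $(w_0,w_1,w_2)=(1,-1,1)$. -/

import Mathlib

open scoped Matrix

/-- A strongly regular graph that is neither empty nor complete; equivalently, edges and non-edges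
form the two classes of a symmetric `2`-class association scheme. -/
def IsStronglyRegular {V : Type*} [Fintype V] [DecidableEq V] (G : SimpleGraph V)
    [DecidableRel G.Adj] : Prop :=
  G ≠ ⊥ ∧ G ≠ ⊤ ∧ ∃ n k l m : ℕ, G.IsSRGWith n k l m

/-- `θ` is an eigenvalue of the adjacency matrix of `G` on the vectors orthogonal to the
all-ones vector. -/
def IsRestrictedEigenvalue {V : Type*} [Fintype V] (G : SimpleGraph V)
    [DecidableRel G.Adj] (θ : ℝ) : Prop :=
  ∃ v : V → ℝ, v ≠ 0 ∧ ∑ x, v x = 0 ∧ G.adjMatrix ℝ *ᵥ v = θ • v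

/-- `G` has eigenvalues `(k, r, s)`: it is regular of valency `k` (the eigenvalue on the all-ones
vector) and its eigenvalues on the orthogonal complement of the all-ones vector are exactly
`r` and `s`. -/
structure HasEigenvalues {V : Type*} [Fintype V] (G : SimpleGraph V)
    [DecidableRel G.Adj] (k r s : ℝ) : Prop where
  valency : ∀ x, (G.degree x : ℝ) = k
  restricted : ∀ θ : ℝ, IsRestrictedEigenvalue G θ ↔ θ = r ∨ θ = s

/-- A conference graph: a strongly regular graph whose eigenvalues `(k, r, s)`, with `r ≥ 0` and
`s ≤ -1`, satisfy `k = 2r(r+1)` and `r + s = -1`. -/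
def IsConferenceGraph {V : Type*} [Fintype V] [DecidableEq V] (G : SimpleGraph V)
    [DecidableRel G.Adj] : Prop :=
  IsStronglyRegular G ∧
    ∃ k r s : ℝ, 0 ≤ r ∧ s ≤ -1 ∧ HasEigenvalues G k r s ∧ k = 2 * r * (r + 1) ∧ r + s = -1

/-- The element `w₀ A₀ + w₁ A₁ + w₂ A₂` of the Bose–Mesner algebra, where `A₀ = I` and `A₁`, `A₂`
are the adjacency matrices of `G` and of its complement. -/
def coreMatrix {V : Type*} [DecidableEq V] (G : SimpleGraph V)
    [DecidableRel G.Adj] (w₀ w₁ w₂ : ℂ) : Matrix V V ℂ :=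
  w₀ • (1 : Matrix V V ℂ) + w₁ • G.adjMatrix ℂ + w₂ • Gᶜ.adjMatrix ℂ

/-- The matrix `M` bordered by a first row and a first column of ones. -/
def borderedMatrix {V : Type*} (M : Matrix V V ℂ) : Matrix (Unit ⊕ V) (Unit ⊕ V) ℂ :=
  Matrix.fromBlocks (Matrix.of fun _ _ => 1) (Matrix.of fun _ _ => 1)
    (Matrix.of fun _ _ => 1) M

/-! The core lies in the Bose–Mesner algebra, so its Gram matrix is αI + βA₁ + γJ, and `W` is
Hadamard iff the core has row sums -1, β = 0 and α = n + 1. Here α and β depend only on the real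
inner products x, y, z of the pairs (w₀,w₁), (w₀,w₂), (w₁,w₂).

For s < -1, since these lie in [-1, 1], `hadamard_parameter_cases` excludes r + s ≥ 1. If r + s =
-1, then w₁ and w₂ are mirror images across the line through w₀, and integrality of n forces the
conference parameters (`conference_solutions`). If r + s = 0, then w₀ = w₂ = -w₁ and k is 2m or 2m +
1. The second value satisfies every equation (with w₀ = -1), so it needs a genuine nonexistence
result, `not_isSRGWith_hadamardDesign`. The case s = -1 leaves only a 1-regular graph on 3 vertices,
which violates the handshake lemma. The converse is substitution. -/

theorem adjMatrix_compl_eq_ones_sub {V R : Type*} [DecidableEq V] [Ring R] (G : SimpleGraph V)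
    [DecidableRel G.Adj] :
    Gᶜ.adjMatrix R = (Matrix.of fun _ _ => 1) - 1 - G.adjMatrix R := by
  ext i j
  rcases eq_or_ne i j with rfl | hij
  · simp
  · by_cases h : G.Adj i j <;> simp [SimpleGraph.adjMatrix_apply, h, hij]

theorem sum_adjMatrix_apply {V R : Type*} [Fintype V] [Semiring R] {G : SimpleGraph V}
    [DecidableRel G.Adj] {k : ℕ} (h : G.IsRegularOfDegree k) (i : V) :
    ∑ j, G.adjMatrix R i j = k := by
  simp [SimpleGraph.adjMatrix_apply, ← h.degree_eq i, ← SimpleGraph.card_neighborFinset_eq_degree,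
    SimpleGraph.neighborFinset_eq_filter]

/-! ### Nonexistence by a trace modulo a prime -/

open SimpleGraph in
/-- A symmetric `2`-`(4m + 3, 2m + 1, m)` design with `m ≥ 1` has no polarity without absolute
points. -/
theorem not_isSRGWith_hadamardDesign {V : Type*} [Fintype V] [DecidableEq V] {G : SimpleGraph V}
    [DecidableRel G.Adj] {m : ℕ} (hm : 1 ≤ m) : ¬ G.IsSRGWith (4 * m + 3) (2 * m + 1) m m := by
  intro h
  -- Modulo q all four parameters become -1, so A² = AJ = -J and all higher powers of A are ±J.
  obtain ⟨q, hq, hqm⟩ := Nat.exists_prime_and_dvd (n := m + 1) (by omega)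
  have := Fact.mk hq
  have hm0 : (m : ZMod q) = -1 := by
    have : ((m + 1 : ℕ) : ZMod q) = 0 := (ZMod.natCast_eq_zero_iff _ _).2 hqm
    push_cast at this
    exact eq_neg_of_add_eq_zero_left this
  set A := G.adjMatrix (ZMod q) with hA
  set J : Matrix V V (ZMod q) := Matrix.of fun _ _ => 1 with hJ
  have hC : Gᶜ.adjMatrix (ZMod q) = J - 1 - A := adjMatrix_compl_eq_ones_sub G
  have hA2 : A ^ 2 = -J := by
    have h2 := h.matrix_eq (α := ZMod q)
    rw [← hA] at h2
    rw [h2, hC]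
    simp only [← Nat.cast_smul_eq_nsmul (ZMod q), Nat.cast_add, Nat.cast_mul, hm0]
    module
  have hAJ : A * J = -J := by
    ext v w
    simp only [Matrix.mul_apply, hJ, Matrix.of_apply, mul_one, hA, sum_adjMatrix_apply h.regular,
      Matrix.neg_apply]
    push_cast
    rw [hm0]
    ring
  have hpow : ∀ j, A ^ (j + 2) = (-1) ^ (j + 1) • J := by
    intro j
    induction j with
    | zero => simp [hA2]
    | succ j ih =>
      rw [show j + 1 + 2 = (j + 2) + 1 by ring, pow_succ', ih, Matrix.mul_smul, hAJ,
        pow_succ _ (j + 1)]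
      simp
  -- In characteristic q, tr(A^q) = (tr A)^q = 0, whereas tr(±J) = ∓1.
  have htr := ZMod.trace_pow_card (p := q) A
  obtain ⟨j, rfl⟩ := Nat.exists_eq_add_of_le' hq.two_le
  rw [hpow, trace_adjMatrix, zero_pow (by omega), Matrix.trace_smul] at htr
  have hJtr : J.trace = -1 := by
    simp only [Matrix.trace, hJ, Matrix.diag_apply, Matrix.of_apply, Finset.sum_const,
      Finset.card_univ, h.card, nsmul_eq_mul, mul_one]
    push_cast
    rw [hm0]
    ring
  rw [hJtr] at htr
  simp at htr

/-! ### Parameters from eigenvalues -/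

/-- The parameters of a strongly regular graph in terms of its eigenvalues. -/
theorem exists_isSRGWith_of_hasEigenvalues {V : Type*} [Fintype V] [DecidableEq V]
    {G : SimpleGraph V} [DecidableRel G.Adj] (hG : IsStronglyRegular G) {k₁ r s : ℝ}
    (heig : HasEigenvalues G k₁ r s) (hrs : r ≠ s) :
    ∃ k l m : ℕ, G.IsSRGWith (Fintype.card V) k l m ∧ k₁ = k ∧ r + s = l - m ∧
      -(r * s) = k - m ∧ (k - r) * (k - s) = (m * Fintype.card V : ℝ) ∧
      0 < k ∧ k + 1 < Fintype.card V := by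
  obtain ⟨hbot, htop, n, k, l, m, h⟩ := hG
  obtain rfl : Fintype.card V = n := h.card
  have hA2 := h.matrix_eq (α := ℝ)
  rw [adjMatrix_compl_eq_ones_sub] at hA2
  simp only [← Nat.cast_smul_eq_nsmul ℝ] at hA2
  -- J kills sum-zero vectors, so r and s are the two roots of one quadratic, and Vieta's formulas
  -- apply.
  have hquad : ∀ θ, IsRestrictedEigenvalue G θ → θ ^ 2 = (k - m) + (l - m) * θ := by
    rintro θ ⟨v, hv, hsum, hθ⟩
    obtain ⟨x, hx⟩ := Function.ne_iff.1 hv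
    have h1 := congrFun (congrArg (· *ᵥ v) hA2) x
    have hJv : (Matrix.of fun _ _ => 1 : Matrix V V ℝ) *ᵥ v = 0 := by
      ext y; simp [Matrix.mulVec, dotProduct, hsum]
    simp only [pow_two, ← Matrix.mulVec_mulVec, hθ, Matrix.mulVec_smul, Matrix.add_mulVec,
      Matrix.sub_mulVec, Matrix.smul_mulVec, Matrix.one_mulVec, hJv, Pi.add_apply, Pi.smul_apply,
      Pi.sub_apply, Pi.zero_apply, smul_eq_mul] at h1
    refine mul_right_cancel₀ hx ?_
    linear_combination h1
  have hr := hquad r ((heig.restricted r).2 (Or.inl rfl))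
  have hs := hquad s ((heig.restricted s).2 (Or.inr rfl))
  have hsum : r + s = l - m := by
    refine mul_left_cancel₀ (sub_ne_zero.2 hrs) ?_
    linear_combination hr - hs
  have hprod : -(r * s) = k - m := by
    linear_combination hr - r * hsum
  obtain ⟨x, y, hxy⟩ := SimpleGraph.ne_bot_iff_exists_adj.1 hbot
  have hk : 0 < k := by
    rw [← h.regular x, SimpleGraph.degree_pos_iff_exists_adj]; exact ⟨y, hxy⟩
  obtain ⟨u, v, huv, hnuv⟩ := SimpleGraph.ne_top_iff_exists_not_adj.1 htop
  refine ⟨k, l, m, h, ?_, hsum, hprod, ?_, hk, ?_⟩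
  · rw [← heig.valency x, h.regular x]
  · have h1 := congrFun (congrArg (· *ᵥ (fun _ => (1 : ℝ))) hA2) x
    have hA1 : G.adjMatrix ℝ *ᵥ (fun _ => (1 : ℝ)) = (k : ℝ) • (fun _ => (1 : ℝ)) := by
      ext y
      simpa only [Matrix.mulVec, dotProduct, mul_one, Pi.smul_apply, smul_eq_mul] using
        sum_adjMatrix_apply h.regular y
    have hJ1 : (Matrix.of fun _ _ => 1 : Matrix V V ℝ) *ᵥ (fun _ => (1 : ℝ))
        = (Fintype.card V : ℝ) • (fun _ => (1 : ℝ)) := by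
      ext y; simp [Matrix.mulVec, dotProduct]
    simp only [pow_two, ← Matrix.mulVec_mulVec, hA1, Matrix.mulVec_smul, Matrix.add_mulVec,
      Matrix.sub_mulVec, Matrix.smul_mulVec, Matrix.one_mulVec, hJ1, Pi.add_apply, Pi.smul_apply,
      Pi.sub_apply, smul_eq_mul] at h1
    linear_combination h1 - k * hsum - hprod
  · have h1 : 0 < Gᶜ.degree u := by
      rw [SimpleGraph.degree_pos_iff_exists_adj]; exact ⟨v, by simp [huv, hnuv]⟩
    have h2 := h.compl.regular u
    omega

/-! ### The Hadamard condition as scalar equations -/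

/-- The bordered matrix is Hadamard iff the core has row sums `-1` and Gram matrix `(n+1) I - J`. -/
theorem isHadamard_borderedMatrix_iff {V : Type*} [Fintype V] [DecidableEq V] {M : Matrix V V ℂ}
    (hM : ∀ i j, ‖M i j‖ = 1) :
    (borderedMatrix M).IsHadamard ↔ (∀ i, ∑ j, M i j = -1) ∧
      M * Mᴴ = (Fintype.card V + 1 : ℂ) • (1 : Matrix V V ℂ) - Matrix.of fun _ _ => 1 := by
  have hunit : ∀ i j, borderedMatrix M i j ∈ unitary ℂ := by
    have hu : ∀ z : ℂ, ‖z‖ = 1 → z ∈ unitary ℂ := fun z hz => by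
      rw [Unitary.mem_iff_self_mul_star, Complex.star_def, Complex.mul_conj, Complex.normSq_eq_norm_sq,
        hz]
      simp
    rintro (i | i) (j | j) <;> simp only [borderedMatrix, Matrix.fromBlocks_apply₁₁,
      Matrix.fromBlocks_apply₁₂, Matrix.fromBlocks_apply₂₁, Matrix.fromBlocks_apply₂₂,
      Matrix.of_apply] <;> apply hu <;> simp [hM]
  have hcard : (Fintype.card (Unit ⊕ V) : ℂ) = Fintype.card V + 1 := by
    simp [add_comm]
  rw [Matrix.isHadamard_iff_mul_conjTranspose (IsRegular.of_ne_zero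
    (by rw [hcard]; exact Nat.cast_add_one_ne_zero _)), and_iff_right hunit, hcard]
  rw [borderedMatrix, Matrix.fromBlocks_conjTranspose, Matrix.fromBlocks_multiply,
    ← Matrix.fromBlocks_one, Matrix.fromBlocks_smul, Matrix.fromBlocks_inj]
  constructor
  · rintro ⟨-, -, h21, h22⟩
    refine ⟨fun i => ?_, ?_⟩
    · have := congrFun (congrFun h21 i) ()
      simp [Matrix.mul_apply] at this
      linear_combination this
    · rw [eq_sub_iff_add_eq, ← h22, add_comm]
      congr 1
      ext i j
      simp [Matrix.mul_apply]
  · rintro ⟨hsum, hmul⟩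
    have hsum' : ∀ i, ∑ j, (starRingEnd ℂ) (M i j) = -1 := fun i => by
      rw [← map_sum, hsum]; simp
    refine ⟨?_, ?_, ?_, ?_⟩
    · ext i j; simp [Matrix.mul_apply, add_comm]
    · ext i j; simp [Matrix.mul_apply, hsum']
    · ext i j; simp [Matrix.mul_apply, hsum]
    · rw [hmul]; ext i j; simp [Matrix.mul_apply]

theorem norm_coreMatrix_apply {V : Type*} [DecidableEq V] {G : SimpleGraph V} [DecidableRel G.Adj]
    {w₀ w₁ w₂ : ℂ} (hw₀ : ‖w₀‖ = 1) (hw₁ : ‖w₁‖ = 1) (hw₂ : ‖w₂‖ = 1) (i j : V) :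
    ‖coreMatrix G w₀ w₁ w₂ i j‖ = 1 := by
  rcases eq_or_ne i j with rfl | hij
  · simp [coreMatrix, hw₀]
  · by_cases h : G.Adj i j <;> simp [coreMatrix, SimpleGraph.adjMatrix_apply, h, hij, hw₁, hw₂]

theorem normSq_eq_of_norm_eq_one {z : ℂ} (hz : ‖z‖ = 1) : z.re * z.re + z.im * z.im = 1 := by
  rw [← Complex.normSq_apply, Complex.normSq_eq_norm_sq, hz, one_pow]

/-- The Gram matrix of an element of the Bose–Mesner algebra. -/
theorem coreMatrix_mul_conjTranspose {V : Type*} [Fintype V] [DecidableEq V] {G : SimpleGraph V}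
    [DecidableRel G.Adj] {k l m : ℕ} (h : G.IsSRGWith (Fintype.card V) k l m) (w₀ w₁ w₂ : ℂ) :
    coreMatrix G w₀ w₁ w₂ * (coreMatrix G w₀ w₁ w₂)ᴴ =
      ((w₀ - w₂) * star (w₀ - w₂) + (w₁ - w₂) * star (w₁ - w₂) * (k - m)) • (1 : Matrix V V ℂ) +
      ((w₀ - w₂) * star (w₁ - w₂) + (w₁ - w₂) * star (w₀ - w₂) +
        (w₁ - w₂) * star (w₁ - w₂) * (l - m)) • G.adjMatrix ℂ +
      ((w₁ - w₂) * star (w₁ - w₂) * m + ((w₀ - w₂) + (w₁ - w₂) * k) * star w₂ +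
        w₂ * star ((w₀ - w₂) + (w₁ - w₂) * k) + w₂ * star w₂ * Fintype.card V) •
        (Matrix.of fun _ _ => 1) := by
  have hA2 := h.matrix_eq (α := ℂ)
  have hAH : (G.adjMatrix ℂ)ᴴ = G.adjMatrix ℂ := by
    ext i j; simp [SimpleGraph.adjMatrix_apply, SimpleGraph.adj_comm]
  set A := G.adjMatrix ℂ with hA
  set J : Matrix V V ℂ := Matrix.of fun _ _ => 1 with hJdef
  have hC : Gᶜ.adjMatrix ℂ = J - 1 - A := adjMatrix_compl_eq_ones_sub G
  have hJH : Jᴴ = J := by ext i j; simp [hJdef]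
  have hAJ : A * J = (k : ℂ) • J := by
    ext i j
    simp only [Matrix.mul_apply, hJdef, Matrix.of_apply, mul_one, hA,
      sum_adjMatrix_apply h.regular, Matrix.smul_apply, smul_eq_mul]
  have hJA : J * A = (k : ℂ) • J := by
    have := congrArg Matrix.conjTranspose hAJ
    simpa [Matrix.conjTranspose_mul, hAH, hJH] using this
  have hJJ : J * J = (Fintype.card V : ℂ) • J := by
    ext i j; simp [hJdef, Matrix.mul_apply]
  rw [hC, pow_two] at hA2
  simp only [← Nat.cast_smul_eq_nsmul ℂ] at hA2
  have hM : coreMatrix G w₀ w₁ w₂ =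
      (w₀ - w₂) • (1 : Matrix V V ℂ) + (w₁ - w₂) • A + w₂ • J := by
    rw [coreMatrix, hC]; module
  rw [hM]
  generalize w₀ - w₂ = a
  generalize w₁ - w₂ = b
  simp only [Matrix.conjTranspose_add, Matrix.conjTranspose_smul, Matrix.conjTranspose_one, hAH, hJH,
    add_mul, mul_add, smul_mul_assoc, mul_smul_comm, one_mul, mul_one, hA2, hAJ, hJA, hJJ,
    star_add, star_mul', star_natCast]
  module

theorem sum_coreMatrix {V : Type*} [Fintype V] [DecidableEq V] {G : SimpleGraph V}
    [DecidableRel G.Adj] {k : ℕ} (h : G.IsRegularOfDegree k) (w₀ w₁ w₂ : ℂ) (i : V) :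
    ∑ j, coreMatrix G w₀ w₁ w₂ i j = w₀ + k * w₁ + (Fintype.card V - 1 - k) * w₂ := by
  have hA : ∑ j, G.adjMatrix ℂ i j = k := sum_adjMatrix_apply h i
  have h1 : ∑ j, (1 : Matrix V V ℂ) i j = 1 := by simp [Matrix.one_apply]
  rw [coreMatrix, adjMatrix_compl_eq_ones_sub]
  simp only [Matrix.add_apply, Matrix.sub_apply, Matrix.smul_apply, smul_eq_mul, Matrix.of_apply,
    Finset.sum_add_distrib, ← Finset.mul_sum, Finset.sum_sub_distrib, hA, h1, Finset.sum_const,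
    Finset.card_univ, nsmul_eq_mul, mul_one]
  ring

/-- The Hadamard condition as a system of equations in the pairwise inner products of the
coefficients. -/
theorem isHadamard_borderedMatrix_coreMatrix_iff {V : Type*} [Fintype V] [DecidableEq V]
    {G : SimpleGraph V} [DecidableRel G.Adj] (hbot : G ≠ ⊥) (htop : G ≠ ⊤) {k l m : ℕ}
    (h : G.IsSRGWith (Fintype.card V) k l m)
    (hkm : (k * k : ℝ) = (k - m) + (l - m) * k + m * Fintype.card V) {w₀ w₁ w₂ : ℂ}
    (hw₀ : ‖w₀‖ = 1) (hw₁ : ‖w₁‖ = 1) (hw₂ : ‖w₂‖ = 1) :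
    (borderedMatrix (coreMatrix G w₀ w₁ w₂)).IsHadamard ↔
      w₀ + k * w₁ + (Fintype.card V - 1 - k) * w₂ = -1 ∧
      (w₀ * star w₁).re - (w₀ * star w₂).re +
        (1 - (w₁ * star w₂).re) * (1 + ((l : ℝ) - m)) = 0 ∧
      2 - 2 * (w₀ * star w₂).re + (2 - 2 * (w₁ * star w₂).re) * (k - m) = Fintype.card V + 1 := by
  rw [isHadamard_borderedMatrix_iff (norm_coreMatrix_apply hw₀ hw₁ hw₂),
    coreMatrix_mul_conjTranspose h]
  obtain ⟨x, y, hxy⟩ := SimpleGraph.ne_bot_iff_exists_adj.1 hbot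
  obtain ⟨u, v, huv, hnuv⟩ := SimpleGraph.ne_top_iff_exists_not_adj.1 htop
  have hsum : (∀ i, ∑ j, coreMatrix G w₀ w₁ w₂ i j = -1) ↔
      w₀ + k * w₁ + (Fintype.card V - 1 - k) * w₂ = -1 := by
    simp only [sum_coreMatrix h.regular]
    exact ⟨fun H => H x, fun H _ => H⟩
  rw [hsum]
  refine and_congr_right fun h0 => ?_
  have hn : (Fintype.card V : ℝ) ≠ 0 := by
    have : Nonempty V := ⟨x⟩
    exact_mod_cast Fintype.card_ne_zero
  generalize Fintype.card V = n at *
  have e0 := normSq_eq_of_norm_eq_one hw₀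
  have e1 := normSq_eq_of_norm_eq_one hw₁
  have e2 := normSq_eq_of_norm_eq_one hw₂
  set α : ℂ := (w₀ - w₂) * star (w₀ - w₂) + (w₁ - w₂) * star (w₁ - w₂) * (k - m) with hα
  set β : ℂ := (w₀ - w₂) * star (w₁ - w₂) + (w₁ - w₂) * star (w₀ - w₂) +
        (w₁ - w₂) * star (w₁ - w₂) * (l - m) with hβ
  set γ : ℂ := (w₁ - w₂) * star (w₁ - w₂) * m + ((w₀ - w₂) + (w₁ - w₂) * k) * star w₂ +
        w₂ * star ((w₀ - w₂) + (w₁ - w₂) * k) + w₂ * star w₂ * n with hγ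
  have hα' : α = ((2 - 2 * (w₀ * star w₂).re + (2 - 2 * (w₁ * star w₂).re) * (k - m) : ℝ) : ℂ) := by
    apply Complex.ext
    · simp [hα]
      linear_combination e0 + e2 + (k - m) * (e1 + e2)
    · simp [hα]
      ring
  have hβ' : β = ((2 * ((w₀ * star w₁).re - (w₀ * star w₂).re +
        (1 - (w₁ * star w₂).re) * (1 + ((l : ℝ) - m))) : ℝ) : ℂ) := by
    apply Complex.ext
    · simp [hβ]
      linear_combination 2 * e2 + (l - m) * (e1 + e2)
    · simp [hβ]
      ring
  -- Applying the Gram matrix to the all-ones vector gives α + kβ + nγ = |row sum|² = 1, so γ = -1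
  -- is not an independent condition.
  have hγ' : (n : ℂ) * γ = 1 - α - k * β := by
    have hk' : (k * k : ℂ) = (k - m) + (l - m) * k + m * n := by exact_mod_cast hkm
    have hs : star w₀ + k * star w₁ + (n - 1 - k) * star w₂ = -1 := by
      simpa using congrArg star h0
    simp only [hα, hβ, hγ, star_add, star_sub, star_mul', star_natCast]
    linear_combination (star w₀ + k * star w₁ + (n - 1 - k) * star w₂) * h0 - hs -
      (w₁ - w₂) * (star w₁ - star w₂) * hk'
  constructor
  · intro H
    have hxx := congrFun (congrFun H x) x
    have hxy' := congrFun (congrFun H x) y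
    have huv' := congrFun (congrFun H u) v
    simp [SimpleGraph.adjMatrix_apply, hxy, hxy.ne] at hxx hxy'
    simp [SimpleGraph.adjMatrix_apply, huv, hnuv] at huv'
    have hβ0 : β = 0 := by linear_combination hxy' - huv'
    have hα0 : α = n + 1 := by linear_combination hxx - huv'
    rw [hβ'] at hβ0
    rw [hα'] at hα0
    have hβ1 := Complex.ofReal_eq_zero.1 hβ0
    exact ⟨by linarith, by exact_mod_cast hα0⟩
  · rintro ⟨H1, H2⟩
    have hβ0 : β = 0 := by rw [hβ', H1]; simp
    have hα0 : α = n + 1 := by rw [hα', H2]; simp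
    have hγ0 : γ = -1 := by
      have hn' : (n : ℂ) ≠ 0 := by exact_mod_cast hn
      apply mul_left_cancel₀ hn'
      rw [hγ', hα0, hβ0]; ring
    rw [hα0, hβ0, hγ0]
    module

/-- The definition of a conference graph brings its own eigenvalues; since s < 0 ≤ r', they cannot
be matched crosswise. -/
theorem HasEigenvalues.eq_of_sign {V : Type*} [Fintype V] [Nonempty V] {G : SimpleGraph V}
    [DecidableRel G.Adj] {k r s k' r' s' : ℝ} (h : HasEigenvalues G k r s)
    (h' : HasEigenvalues G k' r' s') (hs : s < 0) (hr' : 0 ≤ r') :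
    k' = k ∧ r' = r ∧ s' = s := by
  have hk : k' = k := by
    obtain ⟨x⟩ := ‹Nonempty V›
    rw [← h'.valency x, h.valency x]
  have h1 := (h.restricted r').1 ((h'.restricted r').2 (Or.inl rfl))
  have h2 := (h'.restricted s).1 ((h.restricted s).2 (Or.inr rfl))
  refine ⟨hk, ?_, ?_⟩
  · rcases h1 with h1 | h1
    · exact h1
    · linarith
  · rcases h2 with h2 | h2
    · linarith
    · exact h2.symm

/-! ### Geometry of unit complex numbers -/

theorem norm_mul_star_of_norm_eq_one {u v : ℂ} (hu : ‖u‖ = 1) (hv : ‖v‖ = 1) :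
    ‖u * star v‖ = 1 := by
  rw [norm_mul, norm_star, hu, hv, one_mul]

theorem abs_re_mul_star_le_one {u v : ℂ} (hu : ‖u‖ = 1) (hv : ‖v‖ = 1) :
    |(u * star v).re| ≤ 1 :=
  (Complex.abs_re_le_norm _).trans_eq (norm_mul_star_of_norm_eq_one hu hv)

theorem eq_of_re_mul_star_eq_one {u v : ℂ} (hu : ‖u‖ = 1) (hv : ‖v‖ = 1)
    (h : (u * star v).re = 1) : u = v := by
  have eu := normSq_eq_of_norm_eq_one hu
  have ev := normSq_eq_of_norm_eq_one hv
  simp at h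
  have hsq : (u.re - v.re) ^ 2 + (u.im - v.im) ^ 2 = 0 := by linear_combination eu + ev - 2 * h
  apply Complex.ext <;> nlinarith [sq_nonneg (u.re - v.re), sq_nonneg (u.im - v.im)]

theorem eq_neg_of_re_mul_star_eq_neg_one {u v : ℂ} (hu : ‖u‖ = 1) (hv : ‖v‖ = 1)
    (h : (u * star v).re = -1) : u = -v :=
  eq_of_re_mul_star_eq_one hu (by rwa [norm_neg]) (by simp at h ⊢; linarith)

/-- Two distinct unit complex numbers making the same angle with a third one are mirror images. -/
theorem exists_mirror_of_re_mul_star_eq {w₀ w₁ w₂ : ℂ} (hw₀ : ‖w₀‖ = 1) (hw₁ : ‖w₁‖ = 1)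
    (hw₂ : ‖w₂‖ = 1) (hw : w₁ ≠ w₂) (h : (w₀ * star w₁).re = (w₀ * star w₂).re) :
    ∃ y v : ℝ, y ^ 2 + v ^ 2 = 1 ∧ w₁ = w₀ * (y + v * Complex.I) ∧
      w₂ = w₀ * (y - v * Complex.I) ∧ (w₀ * star w₂).re = y ∧
      (w₁ * star w₂).re = 2 * y ^ 2 - 1 := by
  have e0 := normSq_eq_of_norm_eq_one hw₀
  obtain ⟨ζ₁, hζ₁⟩ : ∃ ζ, w₁ = w₀ * ζ := ⟨w₁ / w₀, by
    rw [mul_div_cancel₀]; intro h0; simp [h0] at hw₀⟩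
  obtain ⟨ζ₂, hζ₂⟩ : ∃ ζ, w₂ = w₀ * ζ := ⟨w₂ / w₀, by
    rw [mul_div_cancel₀]; intro h0; simp [h0] at hw₀⟩
  have n1 : ‖ζ₁‖ = 1 := by rw [hζ₁, norm_mul, hw₀, one_mul] at hw₁; exact hw₁
  have n2 : ‖ζ₂‖ = 1 := by rw [hζ₂, norm_mul, hw₀, one_mul] at hw₂; exact hw₂
  have e1 := normSq_eq_of_norm_eq_one n1
  have e2 := normSq_eq_of_norm_eq_one n2
  have r1 : (w₀ * star w₁).re = ζ₁.re := by
    simp [hζ₁]; linear_combination ζ₁.re * e0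
  have r2 : (w₀ * star w₂).re = ζ₂.re := by
    simp [hζ₂]; linear_combination ζ₂.re * e0
  have r3 : (w₁ * star w₂).re = ζ₁.re * ζ₂.re + ζ₁.im * ζ₂.im := by
    simp [hζ₁, hζ₂]; linear_combination (ζ₁.re * ζ₂.re + ζ₁.im * ζ₂.im) * e0
  have hre : ζ₁.re = ζ₂.re := by rw [← r1, ← r2, h]
  have him : ζ₁.im = -ζ₂.im := by
    have h0 : (ζ₁.im - ζ₂.im) * (ζ₁.im + ζ₂.im) = 0 := by
      linear_combination e1 - e2 - (ζ₁.re + ζ₂.re) * hre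
    rcases mul_eq_zero.1 h0 with h0 | h0
    · exact absurd (by rw [hζ₁, hζ₂, Complex.ext hre (sub_eq_zero.1 h0)]) hw
    · linarith
  refine ⟨ζ₁.re, ζ₁.im, by linear_combination e1, ?_, ?_, by rw [r2, hre], ?_⟩
  · rw [Complex.re_add_im, hζ₁]
  · rw [hζ₂]
    congr 1
    apply Complex.ext <;> simp [hre, him]
  · rw [r3, ← hre]
    linear_combination -e1 + ζ₁.im * him

/-! ### Solving the equations -/

/-- The possible parameters when the Hadamard equations are solvable. -/
theorem hadamard_parameter_cases {n k l m : ℕ} {r s x y z : ℝ} (hr : 0 ≤ r) (hs : s ≤ -1)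
    (hrs : -1 ≤ r + s) (hsum : r + s = l - m) (hprod : -(r * s) = k - m)
    (hmn : (k - r) * (k - s) = (m * n : ℝ)) (hk : 0 < k) (hkn : k + 1 < n)
    (hx : -1 ≤ x) (hy : y ≤ 1) (hz : -1 ≤ z)
    (E1 : x - y + (1 - z) * (1 + ((l : ℝ) - m)) = 0)
    (E2 : 2 - 2 * y + (2 - 2 * z) * (k - m) = (n : ℝ) + 1) :
    (k = 1 ∧ n = 3) ∨
      (m < k ∧ 0 < m ∧ l + 1 = m) ∨
      (m + 1 < k ∧ 0 < m ∧ l = m ∧ n + 4 * m + 1 = 4 * k ∧ (k = 2 * m ∨ k = 2 * m + 1) ∧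
        y = 1 ∧ z = -1) := by
  have hkR : (0 : ℝ) < k := by exact_mod_cast hk
  rcases eq_or_lt_of_le hs with rfl | hs'
  -- Disjoint cliques: m = 0 and l = k - 1, so `E1` and `E2` give n = 1 - 2x ≤ 3.
  · left
    have hm : m = 0 := by
      by_contra hm
      have hmR : (m : ℝ) ≠ 0 := by exact_mod_cast hm
      have : (k : ℝ) + 1 = n := by
        apply mul_left_cancel₀ hmR
        linear_combination hmn + (k + 1) * hprod
      have : k + 1 = n := by exact_mod_cast this
      omega
    subst hm
    have hn : (n : ℝ) ≤ 3 := by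
      push_cast at *
      have hl : (l : ℝ) = k - 1 := by linear_combination hprod - hsum
      rw [hl] at E1
      linarith
    have : n ≤ 3 := by exact_mod_cast hn
    omega
  · right
    have hr0 : 0 < r := by linarith
    have hp : (0 : ℝ) < k - m := by rw [← hprod]; nlinarith
    -- This quantity is -(r + 1)(s + 1).
    have hq : (0 : ℝ) < k - l - 1 := by nlinarith
    have hm : 0 < m := by
      rcases Nat.eq_zero_or_pos m with rfl | hm
      · exfalso
        have h0 : (k - r) * (k - s) = (0 : ℝ) := by simpa using hmn
        rcases mul_eq_zero.1 h0 with h0 | h0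
        · push_cast at hprod
          have : r * (s + 1) = 0 := by linear_combination -hprod - h0
          rcases mul_eq_zero.1 this with h | h <;> linarith
        · linarith
      · exact hm
    have hmR : (0 : ℝ) < m := by exact_mod_cast hm
    have hmk : m < k := by
      have : (m : ℝ) < k := by linarith
      exact_mod_cast this
    have hlk : l + 1 < k := by
      have : (l : ℝ) + 1 < k := by linarith
      exact_mod_cast this
    have hF : (k * k : ℝ) - (l - m) * k - (k - m) = m * n := by
      rw [← hsum, ← hprod, ← hmn]; ring
    have hlm : m ≤ l + 1 := by
      have : (m : ℝ) ≤ l + 1 := by linarith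
      exact_mod_cast this
    -- Eliminating y gives n + 1 = 2 - 2x + 2(1 - z)(k - l - 1), while `E1` bounds (1 - z)(1 + l -
    -- m) = y - x by 2.
    have hbound : ((n : ℝ) - 3) * (1 + (l - m)) ≤ 4 * (k - l - 1) := by
      have h1 : ((n : ℝ) - 3) ≤ 2 * (1 - z) * (k - l - 1) := by linarith
      have h2 : (1 - z) * (1 + ((l : ℝ) - m)) ≤ 2 := by linarith
      have h3 : (0 : ℝ) ≤ 1 + (l - m) := by linarith
      nlinarith [mul_le_mul_of_nonneg_right h1 h3, mul_le_mul_of_nonneg_right h2 hq.le]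
    rcases Nat.lt_trichotomy l m with hlt | heq | hgt
    · left
      exact ⟨hmk, hm, by omega⟩
    · right
      subst heq
      have hn : n + 4 * l + 1 ≤ 4 * k := by
        have : (n : ℝ) + 4 * l + 1 ≤ 4 * k := by linarith
        exact_mod_cast this
      -- Otherwise t = k - 2l satisfies t² - t + l ≤ 0, impossible for l ≥ 1.
      have hn' : 4 * k ≤ n + 4 * l + 1 := by
        by_contra hlt
        have h1 : n + 4 * l + 2 ≤ 4 * k := by omega
        have h2 : (n : ℝ) + 4 * l + 2 ≤ 4 * k := by exact_mod_cast h1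
        nlinarith [mul_le_mul_of_nonneg_left h2 hmR.le, sq_nonneg ((k : ℝ) - 2 * l - 1)]
      have hne : n + 4 * l + 1 = 4 * k := le_antisymm hn hn'
      have hneR : (n : ℝ) = 4 * k - 4 * l - 1 := by
        have : (n : ℝ) + 4 * l + 1 = 4 * k := by exact_mod_cast hne
        linarith
      have hz' : z = -1 := by
        have h1 : (1 + z) * (k - l - 1 : ℝ) ≤ 0 := by
          rw [hneR] at E2; linarith
        nlinarith
      refine ⟨hlk, hm, rfl, hne, ?_, ?_, hz'⟩
      · have h0 : ((k : ℝ) - 2 * l) * (k - (2 * l + 1)) = 0 := by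
          rw [hneR] at hF; linear_combination hF
        rcases mul_eq_zero.1 h0 with h0 | h0
        · left
          have : (k : ℝ) = 2 * l := by linarith
          exact_mod_cast this
        · right
          have : (k : ℝ) = 2 * l + 1 := by linarith
          exact_mod_cast this
      · rw [hz'] at E1
        linarith
    · exfalso
      have hgt' : (m : ℝ) + 1 ≤ l := by exact_mod_cast hgt
      -- The difference of the two sides, times m, is m² + (k - m)(k - l - 1). With d = l - m ≥ 1
      -- and q = k - l - 1 this reads n > 2q + d + 2, whence (n - 3)(1 + d) > 4q, against `hbound`.
      have hn : (2 * (k - m) - (l - m) : ℝ) < n := by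
        have : (m : ℝ) * (2 * (k - m) - (l - m)) < m * n := by
          nlinarith [mul_pos hmR hmR, mul_pos hp hq]
        exact lt_of_mul_lt_mul_left this hmR.le
      nlinarith [mul_nonneg hq.le (sub_nonneg.2 hgt'),
        mul_nonneg (sub_nonneg.2 hgt') (sub_nonneg.2 hgt'),
        mul_pos (sub_pos.2 hn) (by linarith : (0 : ℝ) < 1 + (l - m))]

/-- The solutions of the Hadamard equations when `r + s = -1`. -/
theorem conference_solutions {n k m : ℕ} {r : ℝ} {w₀ w₁ w₂ : ℂ} (hw₀ : ‖w₀‖ = 1) (hw₁ : ‖w₁‖ = 1)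
    (hw₂ : ‖w₂‖ = 1) (hw : w₁ ≠ w₂) (hmk : m < k) (hm : 0 < m)
    (hprod : r * (r + 1) = k - m) (hF : (k * k : ℝ) + k - (k - m) = m * n)
    (E0 : w₀ + k * w₁ + (n - 1 - k) * w₂ = -1)
    (E1 : (w₀ * star w₁).re = (w₀ * star w₂).re)
    (E2 : 2 - 2 * (w₀ * star w₂).re + (2 - 2 * (w₁ * star w₂).re) * (k - m) = (n : ℝ) + 1) :
    (k : ℝ) = 2 * r * (r + 1) ∧ (n : ℝ) = (2 * r + 1) ^ 2 ∧
      ((∃ ε : ℂ, (ε = 1 ∨ ε = -1) ∧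
            w₀ = -1 ∧ w₁ = ε * Complex.I ∧ w₂ = -ε * Complex.I) ∨
          (∃ ε : ℂ, (ε = 1 ∨ ε = -1) ∧
            w₀ = 1 ∧
            w₁ = (-1 + ε * Complex.I * (Real.sqrt (4 * r ^ 2 * (r + 1) ^ 2 - 1) : ℂ)) /
              (2 * (r : ℂ) * ((r : ℂ) + 1)) ∧
            w₂ = (-1 - ε * Complex.I * (Real.sqrt (4 * r ^ 2 * (r + 1) ^ 2 - 1) : ℂ)) /
              (2 * (r : ℂ) * ((r : ℂ) + 1)))) := by
  obtain ⟨y, v, hyv, h1, h2, hy, hz⟩ := exists_mirror_of_re_mul_star_eq hw₀ hw₁ hw₂ hw E1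
  rw [hy, hz] at E2
  have hmR : (0 : ℝ) < m := by exact_mod_cast hm
  have hp1 : (1 : ℝ) ≤ k - m := by
    have : (m : ℝ) + 1 ≤ k := by exact_mod_cast hmk
    linarith
  -- With p = k - m, n ≥ 4p + 2 would give 4py² + 2y + 1 ≤ 0, whose discriminant is negative as p ≥
  -- 1. Since mn = k² + m, the bound then yields (k - 2m)² ≤ 0.
  have hn : n + 4 * m ≤ 4 * k + 1 := by
    by_contra hlt
    have h3 : 4 * k + 2 ≤ n + 4 * m := by omega
    have h4 : (4 * k + 2 : ℝ) ≤ n + 4 * m := by exact_mod_cast h3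
    nlinarith [sq_nonneg (y + 1), sq_nonneg y, mul_nonneg (sub_nonneg.2 hp1) (sq_nonneg y)]
  have hnR : (n : ℝ) + 4 * m ≤ 4 * k + 1 := by exact_mod_cast hn
  have hkm : (k : ℝ) = 2 * m := by
    have : ((k : ℝ) - 2 * m) ^ 2 ≤ 0 := by
      nlinarith [mul_le_mul_of_nonneg_left hnR hmR.le]
    nlinarith [sq_nonneg ((k : ℝ) - 2 * m)]
  have hnm : (n : ℝ) = 4 * m + 1 := by
    apply mul_left_cancel₀ hmR.ne'
    rw [← hF, hkm]; ring
  have hp : r * (r + 1) = m := by rw [hprod, hkm]; ring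
  refine ⟨by linarith, by rw [hnm, ← hp]; ring, ?_⟩
  have hkC : (k : ℂ) = 2 * m := by exact_mod_cast hkm
  have hnC : (n : ℂ) = 4 * m + 1 := by exact_mod_cast hnm
  rw [h1, h2, hkC, hnC] at E0
  have hsum : w₀ * (1 + 4 * m * y) = -1 := by linear_combination E0
  have hyc : y * (2 * m * y + 1) = 0 := by rw [hnm, hkm] at E2; linear_combination (-1 / 2) * E2
  rcases mul_eq_zero.1 hyc with rfl | hy0
  · left
    have hw0 : w₀ = -1 := by simpa using hsum
    have hv : (v - 1) * (v + 1) = 0 := by linear_combination hyv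
    rcases mul_eq_zero.1 hv with hv | hv
    -- The sign is opposite to that of v because w₀ = -1.
    · refine ⟨-1, Or.inr rfl, hw0, ?_, ?_⟩
      · rw [h1, hw0, sub_eq_zero.1 hv]; simp
      · rw [h2, hw0, sub_eq_zero.1 hv]; simp
    · refine ⟨1, Or.inl rfl, hw0, ?_, ?_⟩
      · rw [h1, hw0, eq_neg_of_add_eq_zero_left hv]; simp
      · rw [h2, hw0, eq_neg_of_add_eq_zero_left hv]; simp
  · right
    have hy0C : (2 * m * y + 1 : ℂ) = 0 := by exact_mod_cast hy0
    have hw0 : w₀ = 1 := by linear_combination 2 * w₀ * hy0C - hsum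
    have hmC : (2 * m : ℂ) ≠ 0 := by
      exact_mod_cast (by omega : 2 * m ≠ 0)
    have hpC : (2 * (r : ℂ) * ((r : ℂ) + 1)) = 2 * m := by
      have : (r : ℂ) * (r + 1) = m := by exact_mod_cast hp
      linear_combination 2 * this
    have hS0 : (0 : ℝ) ≤ 4 * r ^ 2 * (r + 1) ^ 2 - 1 := by
      have : (1 : ℝ) ≤ m := by exact_mod_cast hm
      have h5 : 4 * r ^ 2 * (r + 1) ^ 2 = 4 * (m * m : ℝ) := by rw [← hp]; ring
      nlinarith
    have hS := Real.mul_self_sqrt hS0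
    set S := Real.sqrt (4 * r ^ 2 * (r + 1) ^ 2 - 1)
    have hv : (2 * m * v - S) * (2 * m * v + S) = 0 := by
      linear_combination (4 * m ^ 2 : ℝ) * hyv - (2 * m * y - 1) * hy0 - hS -
        4 * (r * (r + 1) + m) * hp
    rw [hpC, hw0]
    rcases mul_eq_zero.1 hv with hv | hv
    · have hvC : (2 * m * v - S : ℂ) = 0 := by exact_mod_cast hv
      refine ⟨1, Or.inl rfl, rfl, ?_, ?_⟩
      · rw [h1, hw0, eq_div_iff hmC]; linear_combination hy0C + Complex.I * hvC
      · rw [h2, hw0, eq_div_iff hmC]; linear_combination hy0C - Complex.I * hvC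
    · have hvC : (2 * m * v + S : ℂ) = 0 := by exact_mod_cast hv
      refine ⟨-1, Or.inr rfl, rfl, ?_, ?_⟩
      · rw [h1, hw0, eq_div_iff hmC]; linear_combination hy0C + Complex.I * hvC
      · rw [h2, hw0, eq_div_iff hmC]; linear_combination hy0C - Complex.I * hvC

/-! ### The classification -/

theorem theorem1 {V : Type*} [Fintype V] [DecidableEq V] (G : SimpleGraph V) [DecidableRel G.Adj]
    (hG : IsStronglyRegular G) (k₁ r s : ℝ) (heig : HasEigenvalues G k₁ r s)
    (hr : 0 ≤ r) (hs : s ≤ -1) (hrs : -1 ≤ r + s)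
    (w₀ w₁ w₂ : ℂ) (hw₀ : ‖w₀‖ = 1) (hw₁ : ‖w₁‖ = 1) (hw₂ : ‖w₂‖ = 1) (hw : w₁ ≠ w₂) :
    (borderedMatrix (coreMatrix G w₀ w₁ w₂)).IsHadamard ↔
      ((IsConferenceGraph G ∧ (Fintype.card V : ℝ) = (2 * r + 1) ^ 2) ∧
        ((∃ ε : ℂ, (ε = 1 ∨ ε = -1) ∧
            w₀ = -1 ∧ w₁ = ε * Complex.I ∧ w₂ = -ε * Complex.I) ∨
          (∃ ε : ℂ, (ε = 1 ∨ ε = -1) ∧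
            w₀ = 1 ∧
            w₁ = (-1 + ε * Complex.I * (Real.sqrt (4 * r ^ 2 * (r + 1) ^ 2 - 1) : ℂ)) /
              (2 * (r : ℂ) * ((r : ℂ) + 1)) ∧
            w₂ = (-1 - ε * Complex.I * (Real.sqrt (4 * r ^ 2 * (r + 1) ^ 2 - 1) : ℂ)) /
              (2 * (r : ℂ) * ((r : ℂ) + 1))))) ∨
      (HasEigenvalues G (2 * r ^ 2) r (-r) ∧ w₀ = 1 ∧ w₁ = -1 ∧ w₂ = 1) := by

  obtain ⟨k, l, m, h, rfl, hsum, hprod, hmn, hk, hkn⟩ :=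
    exists_isSRGWith_of_hasEigenvalues hG heig (by linarith)
  have hne : Nonempty V := Fintype.card_pos_iff.1 (by omega)
  have hF : (k * k : ℝ) = (k - m) + (l - m) * k + m * Fintype.card V := by
    rw [← hsum, ← hprod, ← hmn]; ring
  rw [isHadamard_borderedMatrix_coreMatrix_iff hG.1 hG.2.1 h hF hw₀ hw₁ hw₂]
  constructor
  · rintro ⟨E0, E1, E2⟩
    have hx := abs_le.1 (abs_re_mul_star_le_one hw₀ hw₁)
    have hy := abs_le.1 (abs_re_mul_star_le_one hw₀ hw₂)
    have hz := abs_le.1 (abs_re_mul_star_le_one hw₁ hw₂)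
    rcases hadamard_parameter_cases hr hs hrs hsum hprod hmn hk hkn hx.1 hy.2 hz.1 E1 E2 with
      ⟨rfl, hn⟩ | ⟨hmk, hm, hlm⟩ | ⟨hmk, hm, rfl, hn, hkm, hy1, hz1⟩
    · exfalso
      have hsd := G.sum_degrees_eq_twice_card_edges
      simp only [h.regular.degree_eq, Finset.sum_const, Finset.card_univ, hn, smul_eq_mul] at hsd
      omega
    · left
      have hlmR : (l : ℝ) - m = -1 := by
        have : (l : ℝ) + 1 = m := by exact_mod_cast hlm
        linarith
      have hs' : s = -1 - r := by linarith
      rw [hlmR] at hF E1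
      obtain ⟨hk2, hn2, hsol⟩ := conference_solutions (r := r) hw₀ hw₁ hw₂ hw hmk hm
        (by rw [← hprod, hs']; ring) (by linarith) E0 (by linarith) E2
      exact ⟨⟨⟨hG, k, r, s, hr, hs, heig, hk2, by linarith⟩, hn2⟩, hsol⟩
    · right
      have h12 := eq_neg_of_re_mul_star_eq_neg_one hw₁ hw₂ hz1
      have h02 := eq_of_re_mul_star_eq_one hw₀ hw₂ hy1
      have hs' : s = -r := by linarith
      rcases hkm with rfl | rfl
      · have hn' : Fintype.card V + 1 = 4 * l := by omega
        have hnC : (Fintype.card V : ℂ) + 1 = 4 * l := by exact_mod_cast hn'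
        have hw2 : w₂ = 1 := by
          rw [h12, h02] at E0
          push_cast at E0
          linear_combination -E0 + w₂ * hnC
        have hk2 : ((2 * l : ℕ) : ℝ) = 2 * r ^ 2 := by
          rw [hs'] at hprod
          push_cast at hprod ⊢
          linear_combination -2 * hprod
        rw [hk2, hs'] at heig
        exact ⟨heig, by rw [h02, hw2], by rw [h12, hw2], hw2⟩
      · exfalso
        have hn' : Fintype.card V = 4 * l + 3 := by omega
        rw [hn'] at h
        exact not_isSRGWith_hadamardDesign hm h
  · rintro (⟨⟨⟨-, k', r', s', hr', hs', heig', hk', hrs'⟩, hn⟩, hsol⟩ | ⟨heig', rfl, rfl, rfl⟩)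
    · obtain ⟨rfl, rfl, rfl⟩ := heig.eq_of_sign heig' (by linarith) hr'
      have hk0 : r' * (r' + 1) ≠ 0 := by
        intro h0
        have : (0 : ℝ) < k := by exact_mod_cast hk
        nlinarith
      have hlm : (l : ℝ) - m = -1 := by linarith
      have hs2 : s' = -1 - r' := by linarith
      have hp : (k : ℝ) - m = r' * (r' + 1) := by rw [← hprod, hs2]; ring
      have hkC : (k : ℂ) = 2 * r' * (r' + 1) := by exact_mod_cast hk'
      have hnC : (Fintype.card V : ℂ) = (2 * r' + 1) ^ 2 := by exact_mod_cast hn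
      rw [hlm, hp, hn, hkC, hnC]
      rcases hsol with ⟨ε, hε, rfl, rfl, rfl⟩ | ⟨ε, hε, rfl, h1, h2⟩
      · refine ⟨by ring, ?_, ?_⟩
        · rcases hε with rfl | rfl <;> simp
        · rcases hε with rfl | rfl <;> simp <;> ring
      · have hS0 : (0 : ℝ) ≤ 4 * r' ^ 2 * (r' + 1) ^ 2 - 1 := by
          -- r'(r' + 1) = k - m is a positive integer, which makes the radicand nonnegative.
          have hmk : (1 : ℝ) ≤ r' * (r' + 1) := by
            have h0 : 0 < r' * (r' + 1) := lt_of_le_of_ne (by positivity) hk0.symm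
            have h3 : (m : ℝ) < k := by linarith
            have h4 : m + 1 ≤ k := by exact_mod_cast h3
            have h5 : (m : ℝ) + 1 ≤ k := by exact_mod_cast h4
            linarith
          nlinarith
        have hS := Real.mul_self_sqrt hS0
        set S := Real.sqrt (4 * r' ^ 2 * (r' + 1) ^ 2 - 1)
        have hden : 2 * r' * (r' + 1) ≠ 0 := by
          intro h0; apply hk0; linarith
        have hdenC : 2 * (r' : ℂ) * (r' + 1) ≠ 0 := by exact_mod_cast hden
        obtain ⟨e, he, rfl⟩ : ∃ e : ℝ, e * e = 1 ∧ ε = e := by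
          rcases hε with rfl | rfl
          · exact ⟨1, by norm_num, by simp⟩
          · exact ⟨-1, by norm_num, by simp⟩
        obtain ⟨P, hP⟩ : ∃ P, P = 2 * r' * (r' + 1) := ⟨_, rfl⟩
        have hPC : 2 * (r' : ℂ) * (r' + 1) = P := by rw [hP]; push_cast; ring
        have hP0 : P ≠ 0 := hP ▸ hden
        have h1' : w₁ = ⟨-1 / P, e * S / P⟩ := by
          rw [h1, hPC, ← Complex.re_add_im ⟨-1 / P, e * S / P⟩]
          push_cast
          ring
        have h2' : w₂ = ⟨-1 / P, -(e * S) / P⟩ := by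
          rw [h2, hPC, ← Complex.re_add_im ⟨-1 / P, -(e * S) / P⟩]
          push_cast
          ring
        have hSP : S * S = P * P - 1 := by rw [hS, hP]; ring
        refine ⟨?_, ?_, ?_⟩
        · have hw12 : 2 * (r' : ℂ) * (r' + 1) * (w₁ + w₂) = -2 := by
            rw [h1, h2, ← add_div, mul_div_cancel₀ _ hdenC]
            ring
          linear_combination hw12
        · rw [h1', h2']; simp
        · rw [h1', h2']
          simp
          have hn2 : (2 * r' + 1) ^ 2 = 2 * P + 1 := by rw [hP]; ring
          have hp2 : r' * (r' + 1) = P / 2 := by rw [hP]; ring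
          rw [hn2, hp2]
          field_simp
          linear_combination (S * S) * he + hSP
    · obtain ⟨hk', -, hs'⟩ := heig.eq_of_sign heig' (by linarith) hr
      have hr0 : r ≠ 0 := by intro h0; linarith
      have hlm : (l : ℝ) - m = 0 := by linarith
      have hp : (k : ℝ) - m = r ^ 2 := by rw [← hprod, ← hs']; ring
      have hn : (Fintype.card V : ℝ) = 4 * r ^ 2 - 1 := by
        apply mul_left_cancel₀ (pow_ne_zero 2 hr0)
        have hm : (m : ℝ) = r ^ 2 := by linarith
        rw [← hm, ← hmn, ← hk', ← hs', hm]; ring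
      have hkC : (k : ℂ) = 2 * r ^ 2 := by exact_mod_cast hk'.symm
      have hnC : (Fintype.card V : ℂ) = 4 * r ^ 2 - 1 := by exact_mod_cast hn
      rw [hlm, hp, hn, hkC, hnC]
      refine ⟨by ring, by simp, ?_⟩
      simp only [star_one, mul_one, Complex.one_re, Complex.neg_re]
      ring
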